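/- Consider simple types $\sigma ::= o \mid \sigma\to\sigma$ over one ground type $o$, and the following typed $\lambda$-calculi, whose provable equality $\vdash M=N$ is the least congruence containing $\beta$, $\eta$ and any additional conversions listed: - the $\lambda\beta\eta$-calculus (no constants, no additional conversions); - the $\lambda\Omega$-calculus, the $\lambda\beta\eta$-calculus with one constant $\Omega:o$ and no additional conversions; - the $\lambda\mathrm{Y}$-calculus, the $\lambda\beta\eta$-calculus with constants $\mathrm{Y}_\sigma:(\sigma\to\sigma)\to\sigma$ for every type $\sigma$ and the additional conversions $M(\mathrm{Y}_\sigma M)=\mathrm{Y}_\sigma M$ for every term $M:\sigma\to\sigma$. For a type $\alpha$ let $\omega_\alpha=(\alpha\to\alpha)\to(\alpha\to\alpha)$ and, for $m\in\mathbb{N}$, let $\underline{m}_\alpha=\lambda f^{\alpha\to\alpha}.\lambda x^\alpha.f^m(x)$. Let $k\ge 0$ and let $\alpha_1,\dots,\alpha_k,\alpha$ be types. A partial function $f:\mathbb{N}^k\rightharpoonup\mathbb{N}$ is $(\alpha_1,\dots,\alpha_k,\alpha)$-definable in one of these calculi if there is a closed term $F:\omega_{\alpha_1}\to\cdots\to\omega_{\alpha_k}\to\omega_\alpha$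 of that calculus such that, for all $m_1,\dots,m_k,m\in\mathbb{N}$, $$f(m_1,\dots,m_k)\text{ is defined and equal to } m \iff\; \vdash F\,\underline{m_1}_{\alpha_1}\cdots\underline{m_k}_{\alpha_k}=\underline{m}_\alpha .$$ Theorem. For all $k\ge 0$ and all types $\alpha_1,\dots,\alpha_k,\alpha$: 1. every (possibly partial) function $f:\mathbb{N}^k\rightharpoonup\mathbb{N}$ that is $(\alpha_1,\dots,\alpha_k,\alpha)$-definable in the $\lambda\mathrm{Y}$-calculus is $(\alpha_1,\dots,\alpha_k,\alpha)$-definable in the $\lambda\Omega$-calculus; 2. every total function $f:\mathbb{N}^k\to\mathbb{N}$ that is $(\alpha_1,\dots,\alpha_k,\alpha)$-definable in the $\lambda\mathrm{Y}$-calculus is $(\alpha_1,\dots,\alpha_k,\alpha)$-definable in the $\lambda\beta\eta$-calculus. -/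

import Mathlib

namespace LambdaY

/-- Simple types over a single ground type `o`. -/
inductive Ty : Type
  | o : Ty
  | arrow : Ty → Ty → Ty

infixr:60 " ⇒ " => Ty.arrow

/-- Contexts: the types of the free variables, in de Bruijn order. -/
abbrev Ctx : Type := List Ty

/-- Typed de Bruijn variables: `Var Γ σ` is the type of positions of `σ` in `Γ`. -/
inductive Var : Ctx → Ty → Type
  | zero {Γ : Ctx} {σ : Ty} : Var (σ :: Γ) σ
  | succ {Γ : Ctx} {σ τ : Ty} : Var Γ σ → Var (τ :: Γ) σ

/-- Simply typed terms (up to renaming of bound variables) with free variables in `Γ` and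
constants in the signature `C`, where `C σ` is the type of constants of type `σ`. -/
inductive Term (C : Ty → Type) : Ctx → Ty → Type
  | var {Γ : Ctx} {σ : Ty} : Var Γ σ → Term C Γ σ
  | const {Γ : Ctx} {σ : Ty} : C σ → Term C Γ σ
  | app {Γ : Ctx} {σ τ : Ty} : Term C Γ (σ ⇒ τ) → Term C Γ σ → Term C Γ τ
  | lam {Γ : Ctx} {σ τ : Ty} : Term C (σ :: Γ) τ → Term C Γ (σ ⇒ τ)

/-- Extend a renaming under a binder. -/
def Var.lift {Γ Δ : Ctx} {σ : Ty} (r : ∀ τ : Ty, Var Γ τ → Var Δ τ) :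
    ∀ τ : Ty, Var (σ :: Γ) τ → Var (σ :: Δ) τ
  | _, Var.zero => Var.zero
  | _, Var.succ x => Var.succ (r _ x)

namespace Term

variable {C : Ty → Type}

/-- Renaming of free variables. -/
def rename {Γ : Ctx} {σ : Ty} (t : Term C Γ σ) :
    ∀ {Δ : Ctx}, (∀ τ : Ty, Var Γ τ → Var Δ τ) → Term C Δ σ :=
  match t with
  | var x => fun r => var (r _ x)
  | const c => fun _ => const c
  | app M N => fun r => app (M.rename r) (N.rename r)
  | lam M => fun r => lam (M.rename (Var.lift r))

/-- Weakening by one fresh variable. -/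
def weaken {Γ : Ctx} {σ τ : Ty} (t : Term C Γ σ) : Term C (τ :: Γ) σ :=
  t.rename (fun _ x => Var.succ x)

/-- Extend a substitution under a binder. -/
def liftSubst {Γ Δ : Ctx} {σ : Ty} (s : ∀ τ : Ty, Var Γ τ → Term C Δ τ) :
    ∀ τ : Ty, Var (σ :: Γ) τ → Term C (σ :: Δ) τ
  | _, Var.zero => var Var.zero
  | _, Var.succ x => (s _ x).weaken

/-- Simultaneous capture-avoiding substitution. -/
def subst {Γ : Ctx} {σ : Ty} (t : Term C Γ σ) :
    ∀ {Δ : Ctx}, (∀ τ : Ty, Var Γ τ → Term C Δ τ) → Term C Δ σ :=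
  match t with
  | var x => fun s => s _ x
  | const c => fun _ => const c
  | app M N => fun s => app (M.subst s) (N.subst s)
  | lam M => fun s => lam (M.subst (liftSubst s))

/-- The substitution of `N` for the last variable, identity on the others. -/
def instSubst {Γ : Ctx} {σ : Ty} (N : Term C Γ σ) :
    ∀ τ : Ty, Var (σ :: Γ) τ → Term C Γ τ
  | _, Var.zero => N
  | _, Var.succ x => var x

/-- `M[N/x]`, where `x` is the last variable of the context of `M`. -/
def inst {Γ : Ctx} {σ τ : Ty} (M : Term C (σ :: Γ) τ) (N : Term C Γ σ) : Term C Γ τ :=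
  M.subst (instSubst N)

end Term

/-- An extension of the typed `λβη`-calculus: a signature of typed constants together with
additional conversions between terms of the same type in the same context. -/
structure Calculus where
  Const : Ty → Type
  Ax : ∀ {Γ : Ctx} {σ : Ty}, Term Const Γ σ → Term Const Γ σ → Prop

/-- Provable equality `⊢_L M = N` in the calculus `L`: the least congruence containing `β`, `η`
and the additional conversions of `L`. -/
inductive Calculus.Eqv (L : Calculus) :
    ∀ {Γ : Ctx} {σ : Ty}, Term L.Const Γ σ → Term L.Const Γ σ → Prop
  | refl {Γ : Ctx} {σ : Ty} (M : Term L.Const Γ σ) : L.Eqv M M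
  | symm {Γ : Ctx} {σ : Ty} {M N : Term L.Const Γ σ} : L.Eqv M N → L.Eqv N M
  | trans {Γ : Ctx} {σ : Ty} {M N P : Term L.Const Γ σ} : L.Eqv M N → L.Eqv N P → L.Eqv M P
  | app {Γ : Ctx} {σ τ : Ty} {M M' : Term L.Const Γ (σ ⇒ τ)} {N N' : Term L.Const Γ σ} :
      L.Eqv M M' → L.Eqv N N' → L.Eqv (Term.app M N) (Term.app M' N')
  | lam {Γ : Ctx} {σ τ : Ty} {M M' : Term L.Const (σ :: Γ) τ} :
      L.Eqv M M' → L.Eqv (Term.lam M) (Term.lam M')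
  | beta {Γ : Ctx} {σ τ : Ty} (M : Term L.Const (σ :: Γ) τ) (N : Term L.Const Γ σ) :
      L.Eqv (Term.app (Term.lam M) N) (M.inst N)
  | eta {Γ : Ctx} {σ τ : Ty} (M : Term L.Const Γ (σ ⇒ τ)) :
      L.Eqv (Term.lam (Term.app M.weaken (Term.var Var.zero))) M
  | ax {Γ : Ctx} {σ : Ty} {M N : Term L.Const Γ σ} : L.Ax M N → L.Eqv M N

/-- The pure typed `λβη`-calculus. -/
def lambdaBetaEta : Calculus where
  Const := fun _ => Empty
  Ax := fun _ _ => False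

/-- The signature with a single constant `Ω : o`. -/
inductive OmegaConst : Ty → Type
  | Omega : OmegaConst Ty.o

/-- The `λΩ`-calculus: one constant `Ω : o`, no additional conversions. -/
def lambdaOmega : Calculus where
  Const := OmegaConst
  Ax := fun _ _ => False

/-- The signature with a constant `Y_σ : (σ → σ) → σ` for every type `σ`. -/
inductive YConst : Ty → Type
  | Y (σ : Ty) : YConst ((σ ⇒ σ) ⇒ σ)

/-- The fixed-point conversions `M (Y_σ M) = Y_σ M`. -/
inductive YAx : ∀ {Γ : Ctx} {σ : Ty}, Term YConst Γ σ → Term YConst Γ σ → Prop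
  | fix {Γ : Ctx} {σ : Ty} (M : Term YConst Γ (σ ⇒ σ)) :
      YAx (Term.app M (Term.app (Term.const (YConst.Y σ)) M))
        (Term.app (Term.const (YConst.Y σ)) M)

/-- The `λY`-calculus. -/
def lambdaY : Calculus where
  Const := YConst
  Ax := YAx

/-- `ω_α = (α → α) → (α → α)`. -/
def numTy (α : Ty) : Ty := (α ⇒ α) ⇒ (α ⇒ α)

/-- The body `f^m(x)`, where `f` and `x` are the last two variables. -/
def iterBody {C : Ty → Type} (Γ : Ctx) (α : Ty) : ℕ → Term C (α :: (α ⇒ α) :: Γ) α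
  | 0 => Term.var Var.zero
  | m + 1 => Term.app (Term.var (Var.succ Var.zero)) (iterBody Γ α m)

/-- The Church numeral `λ f : α → α. λ x : α. f^m(x)`, as a closed term. -/
def numeral {C : Ty → Type} (α : Ty) (m : ℕ) : Term C [] (numTy α) :=
  Term.lam (Term.lam (iterBody [] α m))

/-- The type `ω_{α₁} → … → ω_{α_k} → ω_α`. -/
def numFunTy : ∀ {k : ℕ}, (Fin k → Ty) → Ty → Ty
  | 0, _, α => numTy α
  | _ + 1, αs, α => numTy (αs 0) ⇒ numFunTy (Fin.tail αs) α

/-- The closed term `F m₁ … m_k` applying `F` to Church numerals. -/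
def appNumerals {C : Ty → Type} : ∀ {k : ℕ} (αs : Fin k → Ty) (α : Ty),
    Term C [] (numFunTy αs α) → (Fin k → ℕ) → Term C [] (numTy α)
  | 0, _, _, F, _ => F
  | _ + 1, αs, α, F, ms =>
      appNumerals (Fin.tail αs) α (Term.app F (numeral (αs 0) (ms 0))) (Fin.tail ms)

/-- The closed term `F` of the calculus `L` `(α₁, …, α_k, α)`-defines the partial function `f`. -/
def Calculus.Defines (L : Calculus) {k : ℕ} (αs : Fin k → Ty) (α : Ty)
    (F : Term L.Const [] (numFunTy αs α)) (f : (Fin k → ℕ) →. ℕ) : Prop :=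
  ∀ (ms : Fin k → ℕ) (m : ℕ), m ∈ f ms ↔ L.Eqv (appNumerals αs α F ms) (numeral α m)

/-- `f` is `(α₁, …, α_k, α)`-definable in the calculus `L`. -/
def Calculus.Definable (L : Calculus) {k : ℕ} (αs : Fin k → Ty) (α : Ty)
    (f : (Fin k → ℕ) →. ℕ) : Prop :=
  ∃ F : Term L.Const [] (numFunTy αs α), L.Defines αs α F f

end LambdaY

/-!
Fix a closed term `F` of the `λY`-calculus. The first ingredient is the two-valued model of monotone
functions over `Prop`, where `Y` is the least fixed point operator. Its domains are finite, so there
one `h_σ` serves all functions: the least fixed point of `f` is `f^h(⊥)`. Let `G` be `F` with each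
`Y_σ` replaced by `λ f. f^h(Y_σ f)`. Then `G = F` is provable in the `λY`-calculus, and the value of
`F` in the model is the value of `G` with the remaining `Y`s read as `⊥` (`exists_eqv_eval_bot`).

Treat the remaining `Y`s in `G` as constants without conversions. By normalization, the term
`G m₁ … mₖ` has an `η`-long normal form `P` (`exists_normal`). The model can test it for
constants: the value of a normal term with all constants read as `⊥`, applied to suitable strict
arguments, is true exactly when the term contains no constants (`Normal.detect_eval_iff`).

* If `P` contains a constant, the test fails at `P`. It succeeds at numerals, so by soundness neither
  `F m₁ … mₖ` in the `λY`-calculus nor `G m₁ … mₖ`, with the `Y`s replaced by constant functions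
  with value `Ω`, in the `λΩ`-calculus is a numeral.
* If `P` is pure, both terms are provably `P`, and the calculi agree on which numeral `P` is, as both
  are conservative over the `λβη`-calculus for pure terms.

Conservativity holds because the models of monotone functions over complete lattices are complete for
pure terms: over sets of terms, normal forms can be read back from their values
(`Normal.quote_eval`, `eqv_of_eval_eq`).

If the function is total, the second case always occurs. Then any term of type `o` may replace `Ω`,
even one that depends on the arguments: in `λ n₁ … nₖ f x y₁ … yₚ. …` the term `x y₁ … yₚ` has
type `o` (`distribute`, `appNumerals_distribute_eqv`).
-/

namespace LambdaY

/-! ### Renaming, substitution and replacement of constants -/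

/-- The calculus with constants `C`, `β`, `η` and no additional conversions. It is an `abbrev` so
that `Term (freeCalculus C).Const` and `Term C` agree up to reducible unfolding. -/
abbrev freeCalculus (C : Ty → Type) : Calculus where
  Const := C
  Ax := fun _ _ => False

/-- A reducible copy of `lambdaY`. -/
abbrev fixCalculus : Calculus where
  Const := YConst
  Ax := YAx

namespace Term

variable {C C' C'' : Ty → Type}

/-- Simultaneous replacement of the constants by `κ` and of the free variables by `s`. Unlike
`subst`, it may change the signature; constants may go to open terms. -/
def translate {Γ : Ctx} {σ : Ty} (t : Term C Γ σ) :
    ∀ {Δ : Ctx}, (∀ τ : Ty, C τ → Term C' Δ τ) → (∀ τ : Ty, Var Γ τ → Term C' Δ τ) →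
      Term C' Δ σ :=
  match t with
  | var x => fun _ s => s _ x
  | const c => fun κ _ => κ _ c
  | app M N => fun κ s => app (M.translate κ s) (N.translate κ s)
  | lam M => fun κ s => lam (M.translate (fun τ c => (κ τ c).weaken) (liftSubst s))

theorem rename_rename {Γ : Ctx} {σ : Ty} (t : Term C Γ σ) :
    ∀ {Δ Θ : Ctx} (r : ∀ τ, Var Γ τ → Var Δ τ) (r' : ∀ τ, Var Δ τ → Var Θ τ),
      (t.rename r).rename r' = t.rename (fun τ x => r' τ (r τ x)) := by
  induction t with
  | var x => intros; rfl
  | const c => intros; rfl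
  | app M N ihM ihN => intro Δ Θ r r'; simp only [rename, ihM, ihN]
  | lam M ih =>
    intro Δ Θ r r'
    simp only [rename, ih]
    congr 2
    funext τ x
    cases x <;> rfl

theorem rename_id {Γ : Ctx} {σ : Ty} (t : Term C Γ σ) : t.rename (fun _ x => x) = t := by
  induction t with
  | var x => rfl
  | const c => rfl
  | app M N ihM ihN => simp only [rename, ihM, ihN]
  | @lam Γ σ τ M ih =>
    have h : Var.lift (σ := σ) (fun υ (x : Var Γ υ) => x) = fun _ x => x := by
      funext υ x
      cases x <;> rfl
    rw [rename.eq_def]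
    simp only [h, ih]

theorem rename_weaken {Γ Δ : Ctx} {σ τ : Ty} (t : Term C Γ σ) (r : ∀ τ, Var Γ τ → Var Δ τ) :
    (t.weaken (τ := τ)).rename (Var.lift r) = (t.rename r).weaken := by
  simp only [weaken, rename_rename]
  rfl

/-- Renaming as a special case of `translate`. -/
theorem rename_eq_translate {Γ : Ctx} {σ : Ty} (t : Term C Γ σ) :
    ∀ {Δ : Ctx} (r : ∀ τ, Var Γ τ → Var Δ τ),
      t.rename r = t.translate (fun _ c => const c) (fun τ x => var (r τ x)) := by
  induction t with
  | var x => intros; rfl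
  | const c => intros; rfl
  | app M N ihM ihN => intro Δ r; simp only [rename, translate, ihM, ihN]
  | lam M ih =>
    intro Δ r
    simp only [rename, translate, ih]
    congr 2
    funext τ x
    cases x <;> rfl

/-- Substitution as a special case of `translate`. -/
theorem subst_eq_translate {Γ : Ctx} {σ : Ty} (t : Term C Γ σ) :
    ∀ {Δ : Ctx} (s : ∀ τ, Var Γ τ → Term C Δ τ),
      t.subst s = t.translate (fun _ c => const c) s := by
  induction t with
  | var x => intros; rfl
  | const c => intros; rfl
  | app M N ihM ihN => intro Δ r; simp only [subst, translate, ihM, ihN]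
  | lam M ih => intro Δ r; simp only [subst, translate, ih]; rfl

theorem translate_rename {Γ : Ctx} {σ : Ty} (t : Term C Γ σ) :
    ∀ {Δ Θ : Ctx} (r : ∀ τ, Var Γ τ → Var Δ τ) (κ : ∀ τ, C τ → Term C' Θ τ)
      (s : ∀ τ, Var Δ τ → Term C' Θ τ),
      (t.rename r).translate κ s = t.translate κ (fun τ x => s τ (r τ x)) := by
  induction t with
  | var x => intros; rfl
  | const c => intros; rfl
  | app M N ihM ihN => intro Δ Θ r κ s; simp only [rename, translate, ihM, ihN]
  | lam M ih =>
    intro Δ Θ r κ s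
    simp only [rename, translate, ih]
    congr 2
    funext τ x
    cases x <;> rfl

theorem rename_translate {Γ : Ctx} {σ : Ty} (t : Term C Γ σ) :
    ∀ {Δ Θ : Ctx} (κ : ∀ τ, C τ → Term C' Δ τ) (s : ∀ τ, Var Γ τ → Term C' Δ τ)
      (r : ∀ τ, Var Δ τ → Var Θ τ),
      (t.translate κ s).rename r =
        t.translate (fun τ c => (κ τ c).rename r) (fun τ x => (s τ x).rename r) := by
  induction t with
  | var x => intros; rfl
  | const c => intros; rfl
  | app M N ihM ihN => intro Δ Θ κ s r; simp only [rename, translate, ihM, ihN]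
  | lam M ih =>
    intro Δ Θ κ s r
    simp only [rename, translate, ih, rename_weaken]
    congr 2
    funext τ x
    cases x with
    | zero => rfl
    | succ x => exact rename_weaken _ _

theorem translate_weaken {Γ Δ : Ctx} {σ υ : Ty} (t : Term C Γ σ)
    (κ : ∀ τ, C τ → Term C' Δ τ) (s : ∀ τ, Var Γ τ → Term C' Δ τ) :
    (t.weaken (τ := υ)).translate (fun τ c => (κ τ c).weaken) (liftSubst s) =
      (t.translate κ s).weaken := by
  simp only [weaken, translate_rename, rename_translate]
  rfl

theorem translate_translate {Γ : Ctx} {σ : Ty} (t : Term C Γ σ) :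
    ∀ {Δ Θ : Ctx} (κ : ∀ τ, C τ → Term C' Δ τ) (s : ∀ τ, Var Γ τ → Term C' Δ τ)
      (κ' : ∀ τ, C' τ → Term C'' Θ τ) (s' : ∀ τ, Var Δ τ → Term C'' Θ τ),
      (t.translate κ s).translate κ' s' =
        t.translate (fun τ c => (κ τ c).translate κ' s')
          (fun τ x => (s τ x).translate κ' s') := by
  induction t with
  | var x => intros; rfl
  | const c => intros; rfl
  | app M N ihM ihN => intro Δ Θ κ s κ' s'; simp only [translate, ihM, ihN]
  | lam M ih =>
    intro Δ Θ κ s κ' s'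
    simp only [translate, ih, translate_weaken]
    congr 2
    funext τ x
    cases x with
    | zero => rfl
    | succ x => exact translate_weaken _ _ _

theorem translate_id {Γ : Ctx} {σ : Ty} (t : Term C Γ σ) :
    t.translate (fun _ c => const c) (fun _ x => var x) = t := by
  rw [← rename_eq_translate, rename_id]

theorem subst_var {Γ : Ctx} {σ : Ty} (t : Term C Γ σ) : t.subst (fun _ x => var x) = t := by
  rw [subst_eq_translate, translate_id]

theorem subst_rename {Γ Δ Θ : Ctx} {σ : Ty} (t : Term C Γ σ) (r : ∀ τ, Var Γ τ → Var Δ τ)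
    (s : ∀ τ, Var Δ τ → Term C Θ τ) :
    (t.rename r).subst s = t.subst (fun τ x => s τ (r τ x)) := by
  simp only [subst_eq_translate, translate_rename]

theorem rename_subst {Γ Δ Θ : Ctx} {σ : Ty} (t : Term C Γ σ) (s : ∀ τ, Var Γ τ → Term C Δ τ)
    (r : ∀ τ, Var Δ τ → Var Θ τ) :
    (t.subst s).rename r = t.subst (fun τ x => (s τ x).rename r) := by
  simp only [subst_eq_translate, rename_translate]
  rfl

theorem subst_subst {Γ Δ Θ : Ctx} {σ : Ty} (t : Term C Γ σ) (s : ∀ τ, Var Γ τ → Term C Δ τ)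
    (s' : ∀ τ, Var Δ τ → Term C Θ τ) :
    (t.subst s).subst s' = t.subst (fun τ x => (s τ x).subst s') := by
  simp only [subst_eq_translate, translate_translate]
  rfl

theorem inst_weaken {Γ : Ctx} {σ τ : Ty} (t : Term C Γ σ) (N : Term C Γ τ) :
    t.weaken.inst N = t := by
  rw [weaken, inst, subst_rename]
  exact subst_var t

theorem subst_weaken {Γ Δ : Ctx} {σ τ : Ty} (t : Term C Γ σ)
    (s : ∀ τ, Var Γ τ → Term C Δ τ) :
    (t.weaken (τ := τ)).subst (liftSubst s) = (t.subst s).weaken := by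
  simp only [weaken, subst_rename, rename_subst]
  rfl

theorem translate_inst {Γ Δ : Ctx} {σ τ : Ty} (M : Term C (σ :: Γ) τ) (N : Term C Γ σ)
    (κ : ∀ τ, C τ → Term C' Δ τ) (s : ∀ τ, Var Γ τ → Term C' Δ τ) :
    (M.inst N).translate κ s =
      (M.translate (fun τ c => (κ τ c).weaken) (liftSubst s)).inst (N.translate κ s) := by
  simp only [inst, subst_eq_translate, translate_translate]
  congr 1
  · funext τ c
    rw [← subst_eq_translate]
    exact (inst_weaken _ _).symm
  · funext τ x
    cases x with
    | zero => rfl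
    | succ x =>
      simp only [liftSubst, ← subst_eq_translate]
      exact (inst_weaken _ _).symm

end Term

open Term

variable {C C' : Ty → Type}

theorem Calculus.Eqv.translate_of_forall_not_ax {L₀ L : Calculus}
    (hL : ∀ {Γ : Ctx} {σ : Ty} {M N : Term L₀.Const Γ σ}, ¬ L₀.Ax M N)
    {Γ : Ctx} {σ : Ty} {M N : Term L₀.Const Γ σ} (h : L₀.Eqv M N) :
    ∀ {Δ : Ctx} (κ : ∀ τ, L₀.Const τ → Term L.Const Δ τ) (s : ∀ τ, Var Γ τ → Term L.Const Δ τ),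
      L.Eqv (M.translate κ s) (N.translate κ s) := by
  induction h with
  | refl M => intros; exact .refl _
  | symm _ ih => intro Δ κ s; exact (ih κ s).symm
  | trans _ _ ih₁ ih₂ => intro Δ κ s; exact (ih₁ κ s).trans (ih₂ κ s)
  | app _ _ ih₁ ih₂ => intro Δ κ s; exact .app (ih₁ κ s) (ih₂ κ s)
  | lam _ ih => intro Δ κ s; exact .lam (ih _ _)
  | beta M N => intro Δ κ s; rw [translate_inst]; exact .beta _ _
  | eta M =>
    intro Δ κ s
    simp only [Term.translate, translate_weaken]
    exact .eta _
  | ax h => exact (hL h).elim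

/-- A replacement of constants and variables maps provable equations of the calculus without
additional conversions to provable equations of any calculus. -/
theorem Calculus.Eqv.translate {L : Calculus} {Γ Δ : Ctx} {σ : Ty} {M N : Term C Γ σ}
    (h : (freeCalculus C).Eqv M N) (κ : ∀ τ, C τ → Term L.Const Δ τ)
    (s : ∀ τ, Var Γ τ → Term L.Const Δ τ) : L.Eqv (M.translate κ s) (N.translate κ s) :=
  h.translate_of_forall_not_ax (L₀ := freeCalculus C) (fun h => h) κ s

theorem Calculus.Eqv.rename {Γ Δ : Ctx} {σ : Ty} {M N : Term C Γ σ}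
    (h : (freeCalculus C).Eqv M N) (r : ∀ τ, Var Γ τ → Var Δ τ) :
    (freeCalculus C).Eqv (M.rename r) (N.rename r) := by
  rw [rename_eq_translate, rename_eq_translate]
  exact h.translate (L := freeCalculus C) _ _

/-! ### Normalization -/

mutual

/-- Neutral terms: a variable or constant applied to normal terms. -/
inductive Neutral : ∀ {Γ : Ctx} {σ : Ty}, Term C Γ σ → Prop
  | var {Γ : Ctx} {σ : Ty} (x : Var Γ σ) : Neutral (.var x)
  | const {Γ : Ctx} {σ : Ty} (c : C σ) : Neutral (.const (Γ := Γ) c)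
  | app {Γ : Ctx} {σ τ : Ty} {M : Term C Γ (σ ⇒ τ)} {N : Term C Γ σ} :
      Neutral M → Normal N → Neutral (.app M N)

/-- `η`-long `β`-normal terms: neutral terms occur as normal terms only at the ground type. -/
inductive Normal : ∀ {Γ : Ctx} {σ : Ty}, Term C Γ σ → Prop
  | neutral {Γ : Ctx} {M : Term C Γ Ty.o} : Neutral M → Normal M
  | lam {Γ : Ctx} {σ τ : Ty} {M : Term C (σ :: Γ) τ} : Normal M → Normal (.lam M)

end

mutual

theorem Neutral.rename {Γ : Ctx} {σ : Ty} {M : Term C Γ σ} :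
    Neutral M → ∀ {Δ : Ctx} (r : ∀ τ, Var Γ τ → Var Δ τ), Neutral (M.rename r)
  | .var _, _, _ => .var _
  | .const c, _, _ => .const c
  | .app hM hN, _, r => .app (hM.rename r) (hN.rename r)

theorem Normal.rename {Γ : Ctx} {σ : Ty} {M : Term C Γ σ} :
    Normal M → ∀ {Δ : Ctx} (r : ∀ τ, Var Γ τ → Var Δ τ), Normal (M.rename r)
  | .neutral h, _, r => .neutral (h.rename r)
  | .lam h, _, _ => .lam (h.rename _)

end

/-- Kripke-style computability predicate: at ground type, being provably equal to a normal term;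
at arrow types, preserving computability in all renamed contexts. -/
def Computable : ∀ {σ : Ty} {Γ : Ctx}, Term C Γ σ → Prop
  | .o, _, M => ∃ N, Normal N ∧ (freeCalculus C).Eqv M N
  | .arrow σ _, Γ, M => ∀ (Δ : Ctx) (r : ∀ υ, Var Γ υ → Var Δ υ) (N : Term C Δ σ),
      Computable N → Computable (.app (M.rename r) N)

theorem Computable.congr : ∀ {σ : Ty} {Γ : Ctx} {M M' : Term C Γ σ},
    Computable M → (freeCalculus C).Eqv M M' → Computable M'
  | .o, _, _, _, ⟨N, hN, h⟩, h' => ⟨N, hN, h'.symm.trans h⟩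
  | .arrow _ _, _, _, _, h, h' => fun Δ r N hN =>
      (h Δ r N hN).congr (.app (h'.rename r) (.refl _))

theorem Computable.rename {σ : Ty} {Γ Δ : Ctx} {M : Term C Γ σ} (h : Computable M)
    (r : ∀ τ, Var Γ τ → Var Δ τ) : Computable (M.rename r) := by
  cases σ with
  | o =>
    obtain ⟨N, hN, e⟩ := h
    exact ⟨N.rename r, hN.rename r, e.rename r⟩
  | arrow σ τ =>
    intro Θ r' N hN
    rw [rename_rename]
    exact h Θ _ N hN

theorem computable_neutral_and_normalizes (σ : Ty) :
    (∀ {Γ : Ctx} {M N : Term C Γ σ}, Neutral N → (freeCalculus C).Eqv M N → Computable M) ∧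
    (∀ {Γ : Ctx} {M : Term C Γ σ}, Computable M → ∃ N, Normal N ∧ (freeCalculus C).Eqv M N) := by
  induction σ with
  | o => exact ⟨fun hN e => ⟨_, .neutral hN, e⟩, fun h => h⟩
  | arrow σ τ ihσ ihτ =>
    refine ⟨fun hN e Δ r P hP => ?_, fun {Γ M} h => ?_⟩
    · obtain ⟨Q, hQ, e'⟩ := ihσ.2 hP
      exact ihτ.1 (.app (hN.rename r) hQ) (.app (e.rename r) e')
    · obtain ⟨N, hN, e⟩ := ihτ.2 (h (σ :: Γ) (fun _ x => .succ x) (.var .zero)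
        (ihσ.1 (.var _) (.refl _)))
      exact ⟨.lam N, .lam hN, (Calculus.Eqv.eta (L := freeCalculus C) M).symm.trans (.lam e)⟩

theorem computable_subst {Γ : Ctx} {σ : Ty} (M : Term C Γ σ) :
    ∀ {Δ : Ctx} (s : ∀ τ, Var Γ τ → Term C Δ τ), (∀ τ x, Computable (s τ x)) →
      Computable (M.subst s) := by
  induction M with
  | var x => intro Δ s hs; exact hs _ x
  | const c => intro Δ s hs; exact (computable_neutral_and_normalizes _).1 (.const c) (.refl _)
  | @app Γ σ τ M N ihM ihN =>
    intro Δ s hs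
    have := ihM s hs Δ (fun _ x => x) _ (ihN s hs)
    rwa [rename_id] at this
  | @lam Γ σ τ M ih =>
    intro Δ s hs Θ r N hN
    refine Computable.congr ?_ (Calculus.Eqv.beta (L := freeCalculus C) _ _).symm
    change Computable (((M.subst (liftSubst s)).rename (Var.lift r)).subst (instSubst N))
    rw [rename_subst, subst_subst]
    refine ih _ fun υ x => ?_
    cases x with
    | zero => exact hN
    | succ x =>
      have : (((s υ x).weaken (τ := σ)).rename (Var.lift r)).subst (instSubst N) =
          (s υ x).rename r := by
        rw [rename_weaken]
        exact inst_weaken _ _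
      exact this ▸ (hs υ x).rename r

/-- Every term is provably equal to an `η`-long normal term. -/
theorem exists_normal {Γ : Ctx} {σ : Ty} (M : Term C Γ σ) :
    ∃ N, Normal N ∧ (freeCalculus C).Eqv M N := by
  have h := computable_subst M (fun _ x => .var x) fun τ x =>
    (computable_neutral_and_normalizes τ).1 (.var x) (.refl _)
  rw [subst_var] at h
  exact (computable_neutral_and_normalizes σ).2 h

/-! ### Monotone models over a complete lattice -/

/-- The hierarchy of monotone functions over a complete lattice, with its pointwise orders. -/
def domLattice (L : Type) [CompleteLattice L] : Ty → (X : Type) × CompleteLattice X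
  | .o => ⟨L, inferInstance⟩
  | .arrow σ τ =>
    let _ := (domLattice L σ).2
    let _ := (domLattice L τ).2
    ⟨(domLattice L σ).1 →o (domLattice L τ).1, inferInstance⟩

/-- The domain interpreting a type: `L` at ground type, monotone functions at arrow types. -/
def Dom (L : Type) [CompleteLattice L] (σ : Ty) : Type := (domLattice L σ).1

instance (L : Type) [CompleteLattice L] (σ : Ty) : CompleteLattice (Dom L σ) :=
  (domLattice L σ).2

namespace Dom

variable {L : Type} [CompleteLattice L] {σ τ : Ty}

/-- Application of a function of the model. -/
def app (f : Dom L (σ ⇒ τ)) (a : Dom L σ) : Dom L τ :=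
  (show Dom L σ →o Dom L τ from f) a

/-- A monotone map as a function of the model. -/
def abs (f : Dom L σ →o Dom L τ) : Dom L (σ ⇒ τ) := f

@[simp] theorem app_abs (f : Dom L σ →o Dom L τ) (a : Dom L σ) : app (abs f) a = f a := rfl

theorem app_mono {f g : Dom L (σ ⇒ τ)} {a b : Dom L σ} (h : f ≤ g) (h' : a ≤ b) :
    app f a ≤ app g b :=
  le_trans ((show Dom L σ →o Dom L τ from f).monotone h')
    ((show (show Dom L σ →o Dom L τ from f) ≤ g from h) b)

theorem le_of_app {f g : Dom L (σ ⇒ τ)} (h : ∀ a, app f a ≤ app g a) : f ≤ g := h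

theorem ext_app {f g : Dom L (σ ⇒ τ)} (h : ∀ a, app f a = app g a) : f = g :=
  OrderHom.ext (α := Dom L σ) (β := Dom L τ) f g (funext h)

theorem bot_app (a : Dom L σ) : app (⊥ : Dom L (σ ⇒ τ)) a = ⊥ :=
  le_bot_iff.1 (app_mono (g := abs ⟨fun _ => ⊥, fun _ _ _ => le_rfl⟩) bot_le le_rfl)

/-- A function of the model as a monotone map. -/
def toOrderHom (f : Dom L (σ ⇒ τ)) : Dom L σ →o Dom L τ := f

/-- The least fixed point operator, as an element of the model. -/
def fix (L : Type) [CompleteLattice L] (σ : Ty) : Dom L ((σ ⇒ σ) ⇒ σ) :=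
  abs ⟨fun f => f.toOrderHom.lfp, fun _ _ h => OrderHom.lfp.monotone h⟩

theorem app_fix (f : Dom L (σ ⇒ σ)) : app f (app (fix L σ) f) = app (fix L σ) f :=
  f.toOrderHom.map_lfp

end Dom

/-- Environments: values for the variables of a context. -/
abbrev Env (L : Type) [CompleteLattice L] (Γ : Ctx) : Type := ∀ σ : Ty, Var Γ σ → Dom L σ

section Eval

variable {L : Type} [CompleteLattice L]

/-- Extend an environment by a value for a new variable. -/
def Env.cons {Γ : Ctx} {σ : Ty} (ρ : Env L Γ) (a : Dom L σ) : Env L (σ :: Γ)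
  | _, .zero => a
  | _, .succ x => ρ _ x

theorem Env.cons_mono {Γ : Ctx} {σ : Ty} {ρ ρ' : Env L Γ} {a a' : Dom L σ} (h : ρ ≤ ρ')
    (h' : a ≤ a') : ρ.cons a ≤ ρ'.cons a' := by
  intro τ x
  cases x with
  | zero => exact h'
  | succ x => exact h _ x

/-- The interpretation of a term, where `κ` interprets the constants; monotone in the
environment. -/
def evalHom (κ : ∀ τ : Ty, C τ → Dom L τ) : ∀ {Γ : Ctx} {σ : Ty}, Term C Γ σ → Env L Γ →o Dom L σ
  | _, _, .var x => ⟨fun ρ => ρ _ x, fun _ _ h => h _ x⟩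
  | _, _, .const c => ⟨fun _ => κ _ c, fun _ _ _ => le_rfl⟩
  | _, _, .app M N => ⟨fun ρ => Dom.app (evalHom κ M ρ) (evalHom κ N ρ), fun _ _ h =>
      Dom.app_mono ((evalHom κ M).monotone h) ((evalHom κ N).monotone h)⟩
  | _, _, .lam M => ⟨fun ρ => Dom.abs ⟨fun a => evalHom κ M (ρ.cons a), fun _ _ h =>
      (evalHom κ M).monotone (Env.cons_mono le_rfl h)⟩, fun _ _ h => Dom.le_of_app fun _ =>
      (evalHom κ M).monotone (Env.cons_mono h le_rfl)⟩

/-- The interpretation of a term. -/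
def eval (κ : ∀ τ : Ty, C τ → Dom L τ) {Γ : Ctx} {σ : Ty} (M : Term C Γ σ) (ρ : Env L Γ) :
    Dom L σ :=
  evalHom κ M ρ

variable (κ : ∀ τ : Ty, C τ → Dom L τ)

@[simp] theorem eval_var {Γ : Ctx} {σ : Ty} (x : Var Γ σ) (ρ : Env L Γ) :
    eval κ (.var x) ρ = ρ _ x := rfl

@[simp] theorem eval_const {Γ : Ctx} {σ : Ty} (c : C σ) (ρ : Env L Γ) :
    eval κ (.const c) ρ = κ _ c := rfl

@[simp] theorem eval_app {Γ : Ctx} {σ τ : Ty} (M : Term C Γ (σ ⇒ τ)) (N : Term C Γ σ)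
    (ρ : Env L Γ) : eval κ (.app M N) ρ = Dom.app (eval κ M ρ) (eval κ N ρ) := rfl

@[simp] theorem app_eval_lam {Γ : Ctx} {σ τ : Ty} (M : Term C (σ :: Γ) τ) (ρ : Env L Γ)
    (a : Dom L σ) : Dom.app (eval κ (.lam M) ρ) a = eval κ M (ρ.cons a) := rfl

theorem eval_rename {Γ : Ctx} {σ : Ty} (t : Term C Γ σ) :
    ∀ {Δ : Ctx} (r : ∀ τ, Var Γ τ → Var Δ τ) (ρ : Env L Δ),
      eval κ (t.rename r) ρ = eval κ t (fun τ x => ρ τ (r τ x)) := by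
  induction t with
  | var x => intros; rfl
  | const c => intros; rfl
  | app M N ihM ihN => intro Δ r ρ; simp only [rename, eval_app, ihM, ihN]
  | lam M ih =>
    intro Δ r ρ
    refine Dom.ext_app fun a => ?_
    simp only [rename, app_eval_lam, ih]
    congr 1
    funext τ x
    cases x <;> rfl

theorem eval_weaken {Γ : Ctx} {σ τ : Ty} (t : Term C Γ σ) (ρ : Env L Γ) (a : Dom L τ) :
    eval κ t.weaken (ρ.cons a) = eval κ t ρ :=
  eval_rename κ t _ _

theorem eval_translate (κ : ∀ τ : Ty, C' τ → Dom L τ) {Γ : Ctx} {σ : Ty} (t : Term C Γ σ) :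
    ∀ {Δ : Ctx} (θ : ∀ τ, C τ → Term C' Δ τ) (s : ∀ τ, Var Γ τ → Term C' Δ τ) (ρ : Env L Δ),
      eval κ (t.translate θ s) ρ =
        eval (fun τ c => eval κ (θ τ c) ρ) t (fun τ x => eval κ (s τ x) ρ) := by
  induction t with
  | var x => intros; rfl
  | const c => intros; rfl
  | app M N ihM ihN => intro Δ θ s ρ; simp only [Term.translate, eval_app, ihM, ihN]
  | lam M ih =>
    intro Δ θ s ρ
    refine Dom.ext_app fun a => ?_
    simp only [Term.translate, app_eval_lam, ih, eval_weaken]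
    congr 1
    funext τ x
    cases x with
    | zero => rfl
    | succ x => exact eval_weaken κ _ ρ a

theorem eval_inst {Γ : Ctx} {σ τ : Ty} (M : Term C (σ :: Γ) τ) (N : Term C Γ σ) (ρ : Env L Γ) :
    eval κ (M.inst N) ρ = eval κ M (ρ.cons (eval κ N ρ)) := by
  rw [inst, subst_eq_translate, eval_translate]
  simp only [eval_const]
  congr 1
  funext τ x
  cases x <;> rfl

/-- Soundness: provably equal terms have the same interpretation if the additional conversions
are valid. -/
theorem Calculus.Eqv.eval_eq {K : Calculus} (κ : ∀ τ : Ty, K.Const τ → Dom L τ)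
    (hκ : ∀ {Γ : Ctx} {σ : Ty} {M N : Term K.Const Γ σ}, K.Ax M N →
      ∀ ρ : Env L Γ, eval κ M ρ = eval κ N ρ)
    {Γ : Ctx} {σ : Ty} {M N : Term K.Const Γ σ} (h : K.Eqv M N) :
    ∀ ρ : Env L Γ, eval κ M ρ = eval κ N ρ := by
  induction h with
  | refl M => exact fun _ => rfl
  | symm _ ih => exact fun ρ => (ih ρ).symm
  | trans _ _ ih₁ ih₂ => exact fun ρ => (ih₁ ρ).trans (ih₂ ρ)
  | app _ _ ih₁ ih₂ => intro ρ; rw [eval_app, eval_app, ih₁, ih₂]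
  | lam _ ih => exact fun ρ => Dom.ext_app fun a => ih _
  | beta M N => intro ρ; rw [eval_inst]; rfl
  | eta M =>
    refine fun ρ => Dom.ext_app fun a => ?_
    rw [app_eval_lam, eval_app, eval_weaken]
    rfl
  | ax h => exact hκ h

end Eval

/-- The interpretation of the constants `Y_σ` by least fixed points. -/
def fixInterp (L : Type) [CompleteLattice L] : ∀ τ : Ty, YConst τ → Dom L τ
  | _, .Y σ => Dom.fix L σ

theorem eval_eq_of_fixCalculus {L : Type} [CompleteLattice L] {Γ : Ctx} {σ : Ty}
    {M N : Term YConst Γ σ} (h : fixCalculus.Eqv M N) (ρ : Env L Γ) :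
    eval (fixInterp L) M ρ = eval (fixInterp L) N ρ := by
  refine Calculus.Eqv.eval_eq (K := fixCalculus) (fixInterp L) ?_ h ρ
  rintro _ _ _ _ ⟨M⟩ ρ
  exact Dom.app_fix _

theorem eval_eq_of_freeCalculus {L : Type} [CompleteLattice L] {Γ : Ctx} {σ : Ty}
    {M N : Term C Γ σ} (h : (freeCalculus C).Eqv M N) (κ : ∀ τ : Ty, C τ → Dom L τ)
    (ρ : Env L Γ) : eval κ M ρ = eval κ N ρ :=
  Calculus.Eqv.eval_eq (K := freeCalculus C) κ (fun h => h.elim) h ρ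

/-! ### Iterating to the least fixed point in a finite model -/

instance (L : Type) [CompleteLattice L] [Finite L] (σ : Ty) : Finite (Dom L σ) := by
  induction σ with
  | o => exact ‹Finite L›
  | arrow σ τ ihσ ihτ =>
    exact Finite.of_injective (fun (f : Dom L (σ ⇒ τ)) a => Dom.app f a)
      fun f g h => Dom.ext_app (congrFun h)

/-- In a finite lattice, one number of iterations from `⊥` reaches the least fixed point of all
monotone maps. -/
theorem exists_iterate_bot_eq_lfp (X : Type) [CompleteLattice X] [Finite X] :
    ∃ n : ℕ, ∀ f : X →o X, f^[n] ⊥ = f.lfp := by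
  have : Finite (X →o X) := Finite.of_injective (fun f a => f a) DFunLike.coe_injective
  have h : ∀ f : X →o X, ∃ n : ℕ, ∀ m, n ≤ m → f^[m] ⊥ = f.lfp := by
    intro f
    have hmono : Monotone fun n : ℕ => f^[n] ⊥ :=
      f.monotone.monotone_iterate_of_le_map bot_le
    obtain ⟨n, hn⟩ := WellFoundedGT.monotone_chain_condition ⟨_, hmono⟩
    have hfix : f (f^[n] ⊥) = f^[n] ⊥ := by
      rw [← Function.iterate_succ_apply' f]
      exact (hn (n + 1) n.le_succ).symm
    have hle : ∀ m, f^[m] ⊥ ≤ f.lfp := by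
      intro m
      induction m with
      | zero => exact bot_le
      | succ m ih =>
        rw [Function.iterate_succ_apply', ← f.map_lfp]
        exact f.monotone ih
    refine ⟨n, fun m hm => le_antisymm (hle m) ?_⟩
    rw [← show f^[n] ⊥ = f^[m] ⊥ from hn m hm]
    exact f.lfp_le_fixed hfix
  choose n hn using h
  obtain ⟨N, hN⟩ := (Set.finite_range n).bddAbove
  exact ⟨N, fun f => hn f N (hN ⟨f, rfl⟩)⟩

/-! ### Detecting constants in the two-valued model -/

/-- The term contains no constants. -/
def Term.ConstFree : ∀ {Γ : Ctx} {σ : Ty}, Term C Γ σ → Prop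
  | _, _, .var _ => True
  | _, _, .const _ => False
  | _, _, .app M N => M.ConstFree ∧ N.ConstFree
  | _, _, .lam M => M.ConstFree

/-- Maps between truth values and the domains over `Prop`. A neutral term whose head and arguments
are free of constants precisely when `p` holds has the value `(detect σ).1 p`, and `(detect σ).2`
reads off from the value of a normal term whether it is free of constants. -/
def detect : ∀ σ : Ty, (Prop →o Dom Prop σ) × (Dom Prop σ →o Prop)
  | .o => ((OrderHom.id : Prop →o Prop), (OrderHom.id : Prop →o Prop))
  | .arrow σ τ =>
    (⟨fun p => Dom.abs ⟨fun a => (detect τ).1 (p ∧ (detect σ).2 a), fun _ _ h =>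
        (detect τ).1.monotone fun hp => ⟨hp.1, (detect σ).2.monotone h hp.2⟩⟩, fun _ _ h =>
        Dom.le_of_app fun _ => (detect τ).1.monotone fun hp => ⟨h hp.1, hp.2⟩⟩,
      ⟨fun d => (detect τ).2 (Dom.app d ((detect σ).1 True)), fun _ _ h =>
        (detect τ).2.monotone (Dom.app_mono h le_rfl)⟩)

theorem detect_false (σ : Ty) : (detect σ).1 False = ⊥ := by
  induction σ with
  | o => rfl
  | arrow σ τ _ ih =>
    refine Dom.ext_app fun a => ?_
    rw [Dom.bot_app, ← ih]
    exact congrArg (detect τ).1 (propext (by simp))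

/-- The environment giving all variables the value read as free of constants. -/
def trueEnv (Γ : Ctx) : Env Prop Γ := fun σ _ => (detect σ).1 True

theorem trueEnv_cons (Γ : Ctx) (σ : Ty) :
    (trueEnv Γ).cons ((detect σ).1 True) = trueEnv (σ :: Γ) := by
  funext τ x
  cases x <;> rfl

mutual

theorem Neutral.exists_detect_eq_eval {Γ : Ctx} {σ : Ty} {M : Term C Γ σ} : Neutral M →
    ∃ p : Prop, eval (fun _ _ => ⊥) M (trueEnv Γ) = (detect σ).1 p ∧ (p ↔ M.ConstFree)
  | .var _ => ⟨True, rfl, Iff.rfl⟩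
  | .const _ => ⟨False, (detect_false _).symm, Iff.rfl⟩
  | .app (N := N) hM hN => by
    obtain ⟨p, hp, hp'⟩ := hM.exists_detect_eq_eval
    refine ⟨p ∧ (detect _).2 (eval (fun _ _ => ⊥) N (trueEnv Γ)), ?_,
      and_congr hp' hN.detect_eval_iff⟩
    rw [eval_app, hp]
    rfl

theorem Normal.detect_eval_iff {Γ : Ctx} {σ : Ty} {M : Term C Γ σ} : Normal M →
    ((detect σ).2 (eval (fun _ _ => ⊥) M (trueEnv Γ)) ↔ M.ConstFree)
  | .neutral h => by
    obtain ⟨p, hp, hp'⟩ := h.exists_detect_eq_eval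
    rw [hp]
    exact hp'
  | .lam (σ := σ) (M := M) h => by
    have := h.detect_eval_iff
    rw [← trueEnv_cons] at this
    exact this

end

/-- Terms without constants. -/
abbrev PureTerm : Ctx → Ty → Type := Term (fun _ => Empty)

/-- A pure term as a term over an arbitrary signature. -/
def Term.embed {Γ : Ctx} {σ : Ty} (M : PureTerm Γ σ) : Term C Γ σ :=
  M.translate (fun _ c => c.elim) (fun _ x => .var x)

theorem liftSubst_var (Γ : Ctx) (σ : Ty) :
    liftSubst (σ := σ) (fun τ (x : Var Γ τ) => (.var x : Term C Γ τ)) = fun _ x => .var x := by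
  funext τ x
  cases x <;> rfl

theorem Term.embed_lam {Γ : Ctx} {σ τ : Ty} (M : PureTerm (σ :: Γ) τ) :
    (Term.lam M).embed = Term.lam (M.embed : Term C (σ :: Γ) τ) := by
  simp only [embed, Term.translate, liftSubst_var]
  congr 2
  funext _ c
  exact c.elim

theorem Term.ConstFree.exists_embed_eq {Γ : Ctx} {σ : Ty} {M : Term C Γ σ} (h : M.ConstFree) :
    ∃ N : PureTerm Γ σ, N.embed = M := by
  induction M with
  | var x => exact ⟨.var x, rfl⟩
  | const c => exact h.elim
  | app M N ihM ihN =>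
    obtain ⟨M', rfl⟩ := ihM h.1
    obtain ⟨N', rfl⟩ := ihN h.2
    exact ⟨.app M' N', rfl⟩
  | lam M ih =>
    obtain ⟨M', rfl⟩ := ih h
    exact ⟨.lam M', embed_lam M'⟩

theorem Term.constFree_pure {Γ : Ctx} {σ : Ty} (M : PureTerm Γ σ) : M.ConstFree := by
  induction M with
  | var x => trivial
  | const c => exact c.elim
  | app M N ihM ihN => exact ⟨ihM, ihN⟩
  | lam M ih => exact ih

theorem Term.translate_embed {C' : Ty → Type} {Γ Δ : Ctx} {σ : Ty} (M : PureTerm Γ σ)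
    (κ : ∀ τ, C τ → Term C' Δ τ) (s : ∀ τ, Var Γ τ → Term C' Δ τ) :
    (M.embed : Term C Γ σ).translate κ s = M.translate (fun _ c => c.elim) s := by
  rw [embed, translate_translate]
  congr 1
  funext _ c
  exact c.elim

theorem eval_embed {L : Type} [CompleteLattice L] (κ : ∀ τ : Ty, C τ → Dom L τ) {Γ : Ctx} {σ : Ty}
    (M : PureTerm Γ σ) (ρ : Env L Γ) :
    eval κ (M.embed : Term C Γ σ) ρ = eval (fun _ _ => ⊥) M ρ := by
  rw [embed, eval_translate]
  congr 1
  funext _ c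
  exact c.elim

theorem detect_eval_pure {σ : Ty} (M : PureTerm [] σ) :
    (detect σ).2 (eval (fun _ _ => ⊥) M (trueEnv [])) := by
  obtain ⟨N, hN, e⟩ := exists_normal M
  rw [eval_eq_of_freeCalculus e]
  exact hN.detect_eval_iff.2 (constFree_pure N)

/-! ### Completeness for pure terms -/

/-- Sets of pure terms of a type, one for each context. For the ground type they form the ground
lattice of the model from which normal forms are read back. -/
abbrev TermSets (σ : Ty) : Type := ∀ Δ : Ctx, Set (PureTerm Δ σ)

/-- The position of a variable counted from the far end of the context (its de Bruijn level), which
does not change when the context is extended. -/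
def Var.level : ∀ {Γ : Ctx} {σ : Ty}, Var Γ σ → ℕ
  | _ :: Γ, _, .zero => Γ.length
  | _, _, .succ x => x.level

theorem Var.level_lt {Γ : Ctx} {σ : Ty} (x : Var Γ σ) : x.level < Γ.length := by
  induction x with
  | zero => exact Nat.lt_succ_self _
  | succ x ih => exact Nat.lt_succ_of_lt ih

theorem Var.level_injective {Γ : Ctx} {σ : Ty} {x y : Var Γ σ} (h : x.level = y.level) :
    x = y := by
  induction x with
  | zero =>
    cases y with
    | zero => rfl
    | succ y => exact absurd y.level_lt (h ▸ lt_irrefl _)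
  | succ x ih =>
    cases y with
    | zero => exact absurd x.level_lt (h.symm ▸ lt_irrefl _)
    | succ y => rw [ih h]

/-- In each context, the variables of type `σ` at level `n`: at most one. -/
def varAt (σ : Ty) (n : ℕ) : TermSets σ := fun _ => {M | ∃ y, M = .var y ∧ y.level = n}

/-- The pair of reflection, which interprets sets of neutral terms, and reification, which reads
normal terms back from an element of the model. Fresh variables are named by their level, so that
neutral terms need not be renamed when the context grows. -/
def quote : ∀ σ : Ty,
    (TermSets σ →o Dom (TermSets .o) σ) × (Dom (TermSets .o) σ →o TermSets σ)
  | .o => ((OrderHom.id : TermSets .o →o TermSets .o), (OrderHom.id : TermSets .o →o TermSets .o))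
  | .arrow σ τ =>
    (⟨fun m => Dom.abs ⟨fun a => (quote τ).1 fun Δ =>
        Set.image2 Term.app (m Δ) ((quote σ).2 a Δ), fun _ _ h =>
        (quote τ).1.monotone fun Δ => Set.image2_subset_left ((quote σ).2.monotone h Δ)⟩,
        fun _ _ h => Dom.le_of_app fun _ =>
          (quote τ).1.monotone fun Δ => Set.image2_subset_right (h Δ)⟩,
      ⟨fun d Δ => Term.lam ''
        (quote τ).2 (Dom.app d ((quote σ).1 (varAt σ Δ.length))) (σ :: Δ), fun _ _ h _ =>
        Set.image_mono ((quote τ).2.monotone (Dom.app_mono h le_rfl) _)⟩)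

/-- The environment interpreting each variable by itself. -/
def levelEnv (Γ : Ctx) : Env (TermSets .o) Γ := fun σ x => (quote σ).1 (varAt σ x.level)

theorem levelEnv_cons (Γ : Ctx) (σ : Ty) :
    (levelEnv Γ).cons ((quote σ).1 (varAt σ Γ.length)) = levelEnv (σ :: Γ) := by
  funext τ x
  cases x <;> rfl

mutual

theorem Neutral.exists_quote_eq_eval {Γ : Ctx} {σ : Ty} {M : PureTerm Γ σ} : Neutral M →
    ∃ m, eval (fun _ _ => ⊥) M (levelEnv Γ) = (quote σ).1 m ∧ m Γ = {M}
  | .var x => ⟨varAt _ x.level, rfl, by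
      ext N
      exact ⟨fun ⟨y, hy, h⟩ => hy.trans (congrArg _ (Var.level_injective h)),
        fun h => ⟨x, h, rfl⟩⟩⟩
  | .const c => c.elim
  | .app (N := N) hM hN => by
    obtain ⟨m, hm, hm'⟩ := hM.exists_quote_eq_eval
    refine ⟨fun Δ => Set.image2 Term.app (m Δ)
      ((quote _).2 (eval (fun _ _ => ⊥) N (levelEnv Γ)) Δ), ?_, ?_⟩
    · rw [eval_app, hm]
      rfl
    · simp only [hm', hN.quote_eval, Set.image2_singleton]

/-- Reading back the value of a normal term yields that term. -/
theorem Normal.quote_eval {Γ : Ctx} {σ : Ty} {M : PureTerm Γ σ} : Normal M →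
    (quote σ).2 (eval (fun _ _ => ⊥) M (levelEnv Γ)) Γ = {M}
  | .neutral h => by
    obtain ⟨m, hm, hm'⟩ := h.exists_quote_eq_eval
    rw [hm]
    exact hm'
  | .lam (σ := σ) (M := M) h => by
    have := h.quote_eval
    rw [← levelEnv_cons] at this
    exact (congrArg (Term.lam '' ·) this).trans Set.image_singleton

end

/-- Completeness of the model over sets of terms: closed pure terms with equal values are provably
equal. -/
theorem eqv_of_eval_eq {σ : Ty} {M N : PureTerm [] σ}
    (h : eval (fun _ _ => ⊥) M (levelEnv []) = eval (fun _ _ => ⊥) N (levelEnv [])) :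
    (freeCalculus fun _ => Empty).Eqv M N := by
  obtain ⟨P, hP, eP⟩ := exists_normal M
  obtain ⟨Q, hQ, eQ⟩ := exists_normal N
  rw [eval_eq_of_freeCalculus eP, eval_eq_of_freeCalculus eQ] at h
  have hPQ : P = Q := by
    refine Set.singleton_eq_singleton_iff.1 (hP.quote_eval.symm.trans ?_)
    rw [h]
    exact hQ.quote_eval
  subst hPQ
  exact eP.trans eQ.symm

/-- The `λY`-calculus is conservative over the `λβη`-calculus for closed pure terms. -/
theorem eqv_of_fixCalculus_embed {σ : Ty} {M N : PureTerm [] σ}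
    (h : fixCalculus.Eqv M.embed N.embed) : (freeCalculus fun _ => Empty).Eqv M N := by
  refine eqv_of_eval_eq ?_
  have := eval_eq_of_fixCalculus h (levelEnv [])
  exact (eval_embed _ M _).symm.trans (this.trans (eval_embed _ N _))

/-- The `λΩ`-calculus is conservative over the `λβη`-calculus for closed pure terms. -/
theorem eqv_of_omega_embed {σ : Ty} {M N : PureTerm [] σ}
    (h : (freeCalculus OmegaConst).Eqv M.embed N.embed) : (freeCalculus fun _ => Empty).Eqv M N := by
  refine eqv_of_eval_eq ?_
  have := eval_eq_of_freeCalculus (C := OmegaConst) h (fun _ _ => ⊥) (levelEnv [])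
  exact (eval_embed _ M _).symm.trans (this.trans (eval_embed _ N _))

/-! ### Numerals -/

theorem iterBody_translate {Γ Δ : Ctx} (α : Ty) (κ : ∀ τ, C τ → Term C' (α :: (α ⇒ α) :: Δ) τ)
    (s : ∀ τ, Var Γ τ → Term C' Δ τ) (m : ℕ) :
    (iterBody Γ α m).translate κ (liftSubst (liftSubst s)) = iterBody Δ α m := by
  induction m with
  | zero => rfl
  | succ m ih => exact congrArg _ ih

theorem numeral_translate {Δ : Ctx} (α : Ty) (m : ℕ) (κ : ∀ τ, C τ → Term C' Δ τ)
    (s : ∀ τ, Var [] τ → Term C' Δ τ) :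
    (numeral α m).translate κ s = .lam (.lam (iterBody Δ α m)) := by
  exact congrArg (fun t => Term.lam (Term.lam t)) (iterBody_translate α _ s m)

theorem numeral_weaken (α τ : Ty) (m : ℕ) :
    (numeral α m : Term C [] _).weaken (τ := τ) = .lam (.lam (iterBody [τ] α m)) := by
  rw [weaken, rename_eq_translate, numeral_translate]

theorem numeral_embed (α : Ty) (m : ℕ) : (numeral α m).embed = (numeral α m : Term C [] _) :=
  numeral_translate α m _ _

theorem appNumerals_translate {k : ℕ} (αs : Fin k → Ty) (α : Ty)
    (F : Term C [] (numFunTy αs α)) (ms : Fin k → ℕ) (κ : ∀ τ, C τ → Term C' [] τ)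
    (s : ∀ τ, Var [] τ → Term C' [] τ) :
    (appNumerals αs α F ms).translate κ s = appNumerals αs α (F.translate κ s) ms := by
  induction k with
  | zero => rfl
  | succ k ih =>
    refine (ih _ _ _).trans ?_
    exact congrArg (fun t => appNumerals _ α (Term.app _ t) _) (numeral_translate _ _ κ s)

theorem Calculus.Eqv.appNumerals {L : Calculus} {k : ℕ} (αs : Fin k → Ty) (α : Ty)
    {F F' : Term L.Const [] (numFunTy αs α)} (h : L.Eqv F F') (ms : Fin k → ℕ) :
    L.Eqv (appNumerals αs α F ms) (appNumerals αs α F' ms) := by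
  induction k with
  | zero => exact h
  | succ k ih => exact ih _ (.app h (.refl _)) _

theorem eval_numeral {L : Type} [CompleteLattice L] (κ : ∀ τ, C τ → Dom L τ) (ρ : Env L [])
    (α : Ty) (m : ℕ) :
    eval κ (numeral α m) ρ = eval (fun _ _ => ⊥) (numeral α m : PureTerm [] _) ρ := by
  rw [← numeral_embed, eval_embed]

theorem eval_appNumerals {L : Type} [CompleteLattice L] (κ : ∀ τ, C τ → Dom L τ)
    (κ' : ∀ τ, C' τ → Dom L τ) (ρ : Env L []) {k : ℕ} (αs : Fin k → Ty) (α : Ty)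
    {F : Term C [] (numFunTy αs α)} {F' : Term C' [] (numFunTy αs α)}
    (h : eval κ F ρ = eval κ' F' ρ) (ms : Fin k → ℕ) :
    eval κ (appNumerals αs α F ms) ρ = eval κ' (appNumerals αs α F' ms) ρ := by
  induction k with
  | zero => exact h
  | succ k ih =>
    refine ih _ ?_ _
    refine congrArg₂ Dom.app h ?_
    exact (eval_numeral κ ρ _ _).trans (eval_numeral κ' ρ _ _).symm

theorem detect_eval_numeral (κ : ∀ τ, C τ → Dom Prop τ) (α : Ty) (m : ℕ) :
    (detect _).2 (eval κ (numeral α m) (trueEnv [])) := by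
  rw [eval_numeral]
  exact detect_eval_pure _

/-! ### Unfolding the fixed point operators -/

/-- `h σ` unfoldings `λ f. f (f (… (Y_σ f)))` of `Y_σ`. -/
def unfoldY (h : Ty → ℕ) (Γ : Ctx) : ∀ τ : Ty, YConst τ → Term YConst Γ τ
  | _, .Y σ => .lam ((Term.app (.var .zero))^[h σ] (.app (.const (.Y σ)) (.var .zero)))

theorem unfoldY_weaken (h : Ty → ℕ) (Γ : Ctx) (υ τ : Ty) (c : YConst τ) :
    (unfoldY h Γ τ c).weaken = unfoldY h (υ :: Γ) τ c := by
  obtain ⟨σ⟩ := c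
  simp only [unfoldY, weaken, Term.rename]
  congr 1
  induction h σ with
  | zero => rfl
  | succ n ih =>
    rw [Function.iterate_succ_apply', Function.iterate_succ_apply']
    exact congrArg (Term.app (.var .zero)) ih

theorem unfoldY_eqv (h : Ty → ℕ) (Γ : Ctx) (τ : Ty) (c : YConst τ) :
    fixCalculus.Eqv (.const c) (unfoldY h Γ τ c) := by
  obtain ⟨σ⟩ := c
  refine (Calculus.Eqv.eta (L := fixCalculus) _).symm.trans (.lam ?_)
  induction h σ with
  | zero => exact .refl _
  | succ n ih =>
    rw [Function.iterate_succ_apply']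
    exact (Calculus.Eqv.ax (L := fixCalculus) (YAx.fix _)).symm.trans (.app (.refl _) ih)

theorem eqv_translate_unfoldY (h : Ty → ℕ) {Γ : Ctx} {σ : Ty} (M : Term YConst Γ σ) :
    fixCalculus.Eqv M (M.translate (unfoldY h Γ) (fun _ x => .var x)) := by
  induction M with
  | var x => exact .refl _
  | const c => exact unfoldY_eqv h _ _ c
  | app M N ihM ihN => exact .app ihM ihN
  | lam M ih =>
    simp only [Term.translate, unfoldY_weaken, liftSubst_var]
    exact .lam ih

theorem eval_unfoldY {L : Type} [CompleteLattice L] {h : Ty → ℕ}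
    (hh : ∀ σ (f : Dom L σ →o Dom L σ), f^[h σ] ⊥ = f.lfp) {Γ : Ctx} {τ : Ty} (c : YConst τ)
    (ρ : Env L Γ) : eval (fun _ _ => ⊥) (unfoldY h Γ τ c) ρ = fixInterp L τ c := by
  obtain ⟨σ⟩ := c
  refine Dom.ext_app fun f => ?_
  refine Eq.trans ?_ (hh σ f.toOrderHom)
  rw [unfoldY, app_eval_lam]
  induction h σ with
  | zero => exact Dom.bot_app (σ := σ ⇒ σ) f
  | succ n ih =>
    rw [Function.iterate_succ_apply', Function.iterate_succ_apply', eval_app, ih]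
    rfl

/-- Finitely many unfoldings, as many as the two-valued model needs, turn a term into a provably
equal one whose value in that model does not change when the remaining fixed point operators are
replaced by `⊥`. -/
theorem exists_eqv_eval_bot {σ : Ty} (F : Term YConst [] σ) :
    ∃ G : Term YConst [] σ, fixCalculus.Eqv F G ∧
      eval (fun _ _ => ⊥) G (trueEnv []) = eval (fixInterp Prop) F (trueEnv []) := by
  choose h hh using fun σ => exists_iterate_bot_eq_lfp (Dom Prop σ)
  refine ⟨_, eqv_translate_unfoldY h F, ?_⟩
  rw [eval_translate]
  simp only [eval_unfoldY hh, eval_var]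

/-- A term whose value in the two-valued model passes the test for constants, when the constants
are `⊥`, is provably equal to a pure term. -/
theorem exists_eqv_embed {σ : Ty} {M : Term C [] σ}
    (h : (detect σ).2 (eval (fun _ _ => ⊥) M (trueEnv []))) :
    ∃ P : PureTerm [] σ, (freeCalculus C).Eqv M P.embed := by
  obtain ⟨N, hN, e⟩ := exists_normal M
  rw [eval_eq_of_freeCalculus e] at h
  obtain ⟨P, rfl⟩ := (hN.detect_eval_iff.1 h).exists_embed_eq
  exact ⟨P, e⟩

theorem Calculus.Eqv.to_fixCalculus {σ : Ty} {M : Term YConst [] σ} {P : PureTerm [] σ}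
    (h : (freeCalculus YConst).Eqv M P.embed) : fixCalculus.Eqv M P.embed := by
  have := h.translate (L := fixCalculus) (fun _ c => .const c) (fun _ x => .var x)
  rwa [translate_id, translate_embed] at this

/-! ### Replacing the remaining constants -/

/-- The constant function with value `z`, of arbitrary type. -/
def constTerm : ∀ {Γ : Ctx} (τ : Ty), Term C Γ Ty.o → Term C Γ τ
  | _, .o, z => z
  | _, .arrow _ τ, z => .lam (constTerm τ z.weaken)

theorem eval_constTerm {L : Type} [CompleteLattice L] (κ : ∀ τ, C τ → Dom L τ) {Γ : Ctx} (τ : Ty)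
    (z : Term C Γ Ty.o) (ρ : Env L Γ) (hz : eval κ z ρ = ⊥) : eval κ (constTerm τ z) ρ = ⊥ := by
  induction τ generalizing Γ with
  | o => exact hz
  | arrow σ τ _ ih =>
    refine Dom.ext_app fun a => ?_
    rw [constTerm, app_eval_lam, Dom.bot_app]
    exact ih _ _ ((eval_weaken κ z ρ a).trans hz)

/-- The `λΩ`-term comes from `F` by unfolding the fixed point operators often enough for the
two-valued model and replacing the remaining ones by constant functions with value `Ω`. -/
theorem definable_omega {k : ℕ} {αs : Fin k → Ty} {α : Ty} {f : (Fin k → ℕ) →. ℕ}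
    (hf : fixCalculus.Definable αs α f) : (freeCalculus OmegaConst).Definable αs α f := by
  obtain ⟨F, hF⟩ := hf
  obtain ⟨G, hFG, hG⟩ := exists_eqv_eval_bot F
  refine ⟨G.translate (fun τ _ => constTerm τ (.const .Omega)) (fun _ x => .var x),
    fun ms m => (hF ms m).trans ?_⟩
  have eY := Calculus.Eqv.appNumerals (L := fixCalculus) αs α hFG ms
  have hG' := eval_appNumerals _ _ _ αs α hG ms
  by_cases h : (detect _).2 (eval (fun _ _ => ⊥) (appNumerals αs α G ms) (trueEnv []))
  -- `F m₁ … mₖ` and its counterpart in the `λΩ`-calculus are the same pure term `P`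
  · obtain ⟨P, hP⟩ := exists_eqv_embed h
    have e₁ := eY.trans hP.to_fixCalculus
    have e₂ : (freeCalculus OmegaConst).Eqv (appNumerals αs α (G.translate
        (fun τ _ => constTerm τ (.const .Omega)) (fun _ x => .var x)) ms) P.embed := by
      have := hP.translate (L := freeCalculus OmegaConst) (fun τ _ => constTerm τ (.const .Omega))
        (fun _ x => .var x)
      rw [appNumerals_translate, translate_embed] at this
      exact this
    refine ⟨fun e => e₂.trans ?_, fun e => e₁.trans ?_⟩
    · have := e₁.symm.trans e
      rw [← numeral_embed] at this ⊢
      exact (eqv_of_fixCalculus_embed this).translate (L := freeCalculus OmegaConst) _ _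
    · have := e₂.symm.trans e
      rw [← numeral_embed] at this ⊢
      exact (eqv_of_omega_embed this).translate (L := fixCalculus) _ _
  -- neither of the two is a numeral, since numerals pass the test for constants
  · refine ⟨fun e => (h ?_).elim, fun e => (h ?_).elim⟩
    · rw [hG', eval_eq_of_fixCalculus e]
      exact detect_eval_numeral _ _ _
    · have := detect_eval_numeral (C := OmegaConst) (fun _ _ => ⊥) α m
      rw [← eval_eq_of_freeCalculus (C := OmegaConst) e, ← appNumerals_translate,
        eval_translate] at this
      have hΩ : ∀ τ, eval (fun _ _ => ⊥) (constTerm τ (.const OmegaConst.Omega)) (trueEnv []) = ⊥ :=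
        fun τ => eval_constTerm _ _ _ _ rfl
      simp only [hΩ, eval_var] at this
      exact this

/-! ### Pushing a parameter of ground type inside -/

/-- From `g : o → σ → τ`, the function `z ↦ g z y` with `y` a new variable. -/
def push {Γ : Ctx} {σ τ : Ty} (g : Term C Γ (Ty.o ⇒ σ ⇒ τ)) : Term C (σ :: Γ) (Ty.o ⇒ τ) :=
  .lam (.app (.app g.weaken.weaken (.var .zero)) (.var (.succ .zero)))

/-- The term `λ y₁ … yₚ. g (x y₁ … yₚ) y₁ … yₚ`: although there need be no closed term of type `o`,
the term `x y₁ … yₚ` can serve as the parameter of `g`. -/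
def fill : ∀ {Γ : Ctx} (α : Ty), Term C Γ (Ty.o ⇒ α) → Term C Γ α → Term C Γ α
  | _, .o, g, x => .app g x
  | _, .arrow _ β, g, x => .lam (fill β (push g) (.app x.weaken (.var .zero)))

/-- The term `λ n₁ … nₖ f x y₁ … yₚ. g (x y₁ … yₚ) n₁ … nₖ f x y₁ … yₚ`. -/
def distribute : ∀ {k : ℕ} {Γ : Ctx} (αs : Fin k → Ty) (α : Ty),
    Term C Γ (Ty.o ⇒ numFunTy αs α) → Term C Γ (numFunTy αs α)
  | 0, _, _, α, g => .lam (.lam (fill α (push (push g)) (.var .zero)))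
  | _ + 1, _, αs, α, g => .lam (distribute (Fin.tail αs) α (push g))

theorem push_subst {Γ Δ : Ctx} {σ τ : Ty} (g : Term C Γ (Ty.o ⇒ σ ⇒ τ))
    (s : ∀ τ, Var Γ τ → Term C Δ τ) : (push g).subst (liftSubst s) = push (g.subst s) := by
  simp only [push, Term.subst, subst_weaken]
  rfl

theorem fill_subst {Γ Δ : Ctx} (α : Ty) (g : Term C Γ (Ty.o ⇒ α)) (x : Term C Γ α)
    (s : ∀ τ, Var Γ τ → Term C Δ τ) :
    (fill α g x).subst s = fill α (g.subst s) (x.subst s) := by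
  induction α generalizing Γ Δ with
  | o => rfl
  | arrow σ τ _ ih =>
    simp only [fill, Term.subst, ih, push_subst, subst_weaken]
    rfl

theorem distribute_subst {k : ℕ} {Γ Δ : Ctx} (αs : Fin k → Ty) (α : Ty)
    (g : Term C Γ (Ty.o ⇒ numFunTy αs α)) (s : ∀ τ, Var Γ τ → Term C Δ τ) :
    (distribute αs α g).subst s = distribute αs α (g.subst s) := by
  induction k generalizing Γ Δ with
  | zero =>
    simp only [distribute, Term.subst, fill_subst]
    exact congrArg (fun t => Term.lam (.lam (fill α t _)))
      ((push_subst _ _).trans (congrArg _ (push_subst _ _)))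
  | succ k ih =>
    simp only [distribute, Term.subst, ih]
    exact congrArg (fun t => Term.lam (distribute _ α t)) (push_subst _ _)

theorem lam_weaken_weaken {Γ : Ctx} {σ τ υ : Ty} (Q : Term C Γ σ) :
    (Term.lam (Q.weaken (τ := τ))).weaken (τ := υ) = .lam Q.weaken.weaken :=
  congrArg Term.lam (rename_weaken Q _)

theorem push_eqv {Γ : Ctx} {σ τ : Ty} {g : Term C Γ (Ty.o ⇒ σ ⇒ τ)} {Q : Term C Γ (σ ⇒ τ)}
    (h : (freeCalculus C).Eqv g (.lam Q.weaken)) :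
    (freeCalculus C).Eqv (push g) (.lam (Term.app Q.weaken (.var .zero)).weaken) := by
  refine .lam (.app ?_ (.refl _))
  have h' := (h.rename fun _ x => Var.succ (τ := σ) x).rename fun _ x => Var.succ (τ := Ty.o) x
  refine (Calculus.Eqv.app h' (.refl _)).trans ?_
  have := Calculus.Eqv.beta (L := freeCalculus C) (Q.weaken (τ := σ)).weaken.weaken
    (.var (.zero (Γ := σ :: Γ) (σ := Ty.o)))
  rw [inst_weaken, ← lam_weaken_weaken, ← lam_weaken_weaken] at this
  exact this

theorem fill_eqv {Γ : Ctx} {α : Ty} {g : Term C Γ (Ty.o ⇒ α)} {Q : Term C Γ α}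
    (h : (freeCalculus C).Eqv g (.lam Q.weaken)) (x : Term C Γ α) :
    (freeCalculus C).Eqv (fill α g x) Q := by
  induction α generalizing Γ with
  | o =>
    have := Calculus.Eqv.beta (L := freeCalculus C) Q.weaken x
    rw [inst_weaken] at this
    exact (Calculus.Eqv.app h (.refl _)).trans this
  | arrow σ τ _ ih =>
    exact (Calculus.Eqv.lam (ih (push_eqv h) _)).trans (Calculus.Eqv.eta (L := freeCalculus C) _)

theorem push_inst_eqv {Γ : Ctx} {σ τ : Ty} {g : Term C Γ (Ty.o ⇒ σ ⇒ τ)}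
    {H : Term C (Ty.o :: Γ) (σ ⇒ τ)} (h : (freeCalculus C).Eqv g (.lam H)) (N : Term C Γ σ) :
    (freeCalculus C).Eqv ((push g).inst N) (.lam (.app H N.weaken)) := by
  have e : (push g).inst N = .lam (.app (.app g.weaken (.var .zero)) N.weaken) := by
    simp only [push, Term.inst, Term.subst, subst_weaken]
    have := inst_weaken g N
    rw [Term.inst] at this
    rw [this]
    rfl
  rw [e]
  refine .lam (.app ?_ (.refl _))
  refine (Calculus.Eqv.app (h.rename fun _ x => Var.succ x) (.refl _)).trans ?_
  refine (Calculus.Eqv.beta (L := freeCalculus C) _ _).trans ?_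
  rw [Term.inst, subst_rename]
  have : (fun τ x => instSubst (.var .zero) τ (Var.lift (fun _ x => Var.succ x) τ x)) =
      fun τ (x : Var (Ty.o :: Γ) τ) => (.var x : Term C _ τ) := by
    funext τ x
    cases x <;> rfl
  rw [this, subst_var]
  exact .refl _

/-- If `g` is provably `λ z. G'`, where `G'` is `G` with its constants replaced, and `G m₁ … mₖ`
becomes a term `Q` without `z`, then `distribute g m₁ … mₖ` is provably `Q`. -/
theorem appNumerals_distribute_eqv {k : ℕ} (αs : Fin k → Ty) (α : Ty)
    (κ : ∀ τ, C τ → Term C' [Ty.o] τ) (s : ∀ τ, Var [] τ → Term C' [Ty.o] τ)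
    (G : Term C [] (numFunTy αs α)) (g : Term C' [] (Ty.o ⇒ numFunTy αs α)) (ms : Fin k → ℕ)
    (Q : Term C' [] (numTy α)) (hg : (freeCalculus C').Eqv g (.lam (G.translate κ s)))
    (hQ : (freeCalculus C').Eqv ((appNumerals αs α G ms).translate κ s) Q.weaken) :
    (freeCalculus C').Eqv (appNumerals αs α (distribute αs α g) ms) Q := by
  induction k with
  | zero =>
    refine (Calculus.Eqv.lam (.lam (fill_eqv
      (push_eqv (push_eqv (hg.trans (.lam hQ)))) _))).trans ?_
    exact (Calculus.Eqv.lam (Calculus.Eqv.eta (L := freeCalculus C') _)).trans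
      (Calculus.Eqv.eta (L := freeCalculus C') _)
  | succ k ih =>
    have e := Calculus.Eqv.beta (L := freeCalculus C') (distribute (Fin.tail αs) α (push g))
      (numeral (αs 0) (ms 0))
    have e' : (distribute (Fin.tail αs) α (push g)).inst (numeral (αs 0) (ms 0)) =
        distribute (Fin.tail αs) α ((push g).inst (numeral (αs 0) (ms 0))) :=
      distribute_subst _ _ _ _
    rw [e'] at e
    refine (Calculus.Eqv.appNumerals _ _ e (Fin.tail ms)).trans ?_
    refine ih (Fin.tail αs) (.app G (numeral (αs 0) (ms 0))) _ _ ?_ hQ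
    have e'' := numeral_translate (αs 0) (ms 0) κ s
    rw [← numeral_weaken] at e''
    refine (push_inst_eqv hg _).trans (.lam (.app (.refl _) ?_))
    rw [← e'']
    exact .refl _

/-- For a total function, the constant `Ω` is replaced by a term in the arguments. -/
theorem definable_pure {k : ℕ} {αs : Fin k → Ty} {α : Ty} {f : (Fin k → ℕ) → ℕ}
    (hf : fixCalculus.Definable αs α (f : (Fin k → ℕ) →. ℕ)) :
    (freeCalculus fun _ => Empty).Definable αs α (f : (Fin k → ℕ) →. ℕ) := by
  obtain ⟨F, hF⟩ := hf
  obtain ⟨G, hFG, hG⟩ := exists_eqv_eval_bot F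
  let κ : ∀ τ, YConst τ → PureTerm [Ty.o] τ := fun τ _ => constTerm τ (.var .zero)
  let s : ∀ τ, Var [] τ → PureTerm [Ty.o] τ := fun τ x => .var x.succ
  refine ⟨distribute αs α (.lam (G.translate κ s)), fun ms m => ?_⟩
  have hm : fixCalculus.Eqv (appNumerals αs α F ms) (numeral α (f ms)) :=
    (hF ms (f ms)).1 (Part.mem_some _)
  obtain ⟨P, hP⟩ : ∃ P : PureTerm [] (numTy α),
      (freeCalculus YConst).Eqv (appNumerals αs α G ms) P.embed := by
    refine exists_eqv_embed ?_
    rw [eval_appNumerals _ _ _ αs α hG ms, eval_eq_of_fixCalculus hm]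
    exact detect_eval_numeral _ _ _
  have e₁ := (Calculus.Eqv.appNumerals (L := fixCalculus) αs α hFG ms).trans hP.to_fixCalculus
  have e₂ : (freeCalculus fun _ => Empty).Eqv
      (appNumerals αs α (distribute αs α (.lam (G.translate κ s))) ms) P := by
    refine appNumerals_distribute_eqv αs α κ s G _ ms P (.refl _) ?_
    have := hP.translate (L := freeCalculus fun _ => Empty) κ s
    rw [translate_embed] at this
    rw [weaken, rename_eq_translate]
    convert this using 2
  refine (hF ms m).trans ⟨fun e => e₂.trans ?_, fun e => e₁.trans ?_⟩
  · have := e₁.symm.trans e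
    rw [← numeral_embed] at this
    exact eqv_of_fixCalculus_embed this
  · rw [← numeral_embed]
    exact (e₂.symm.trans e).translate (C := fun _ => Empty) (L := fixCalculus) _ _

end LambdaY

theorem theorem1 :
    (∀ (k : ℕ) (αs : Fin k → LambdaY.Ty) (α : LambdaY.Ty) (f : (Fin k → ℕ) →. ℕ),
      LambdaY.lambdaY.Definable αs α f → LambdaY.lambdaOmega.Definable αs α f) ∧
    (∀ (k : ℕ) (αs : Fin k → LambdaY.Ty) (α : LambdaY.Ty) (f : (Fin k → ℕ) → ℕ),
      LambdaY.lambdaY.Definable αs α (f : (Fin k → ℕ) →. ℕ) →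
        LambdaY.lambdaBetaEta.Definable αs α (f : (Fin k → ℕ) →. ℕ)) :=
  ⟨fun _ _ _ _ h => LambdaY.definable_omega h,
    fun _ _ _ _ h => LambdaY.definable_pure h⟩
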